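/- All logarithms are to base $2$ and all Hilbert spaces are finite dimensional. For a bipartite state $\rho$ let $\rho^\Gamma=(\mathrm{id}\otimes T)(\rho)$ be its partial transpose, let $S(\rho)=-\mathrm{Tr}(\rho\log\rho)$, let $D(\rho\|\sigma)=\mathrm{Tr}(\rho\log\rho-\rho\log\sigma)$ (with value $+\infty$ unless $\ker\sigma\subseteq\ker\rho$), and let $G(\rho_X)=\log|X|-S(\rho_X)$ be the global purity of a state of a system $X$ of dimension $|X|$. $\mathrm{CLODCC}(A:C:B)$ is the class of operations on systems held by three parties $A,C,B$ generated by compositions (infinite ones being understood as limits) of (i) local unitaries of the parties and (ii) sending a subsystem from one party to another through the channel that dephases it completely in the computational basis. For a positive integer $d$, a local idit $\alpha_m$ at $A$ with $m=\log d$ is a state $$\alpha_m=U\,(|+\rangle\langle+|_{\hat A}\otimes\sigma_{A'B'})\,U^\dagger,\qquad U=\sum_{i=0}^{d-1}|i\rangle\langle i|_{\hat A}\otimes U_i,\qquad |+\rangle=\tfrac1{\sqrt d}\sum_{i=0}^{d-1}|i\rangle ,$$ with $\hat A$ of dimension $d$, $\hat AA'$ held by $A$, $B'$ held by $B$, $\sigma_{A'B'}$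 any state and $U_i$ any unitaries on $A'B'$. For states $\rho_{AC_1}$ and $\tilde\rho_{C_2B}$, with $C=C_1C_2$, the repeated private randomness is $$\mathcal R_A^{A\leftrightarrow C\leftrightarrow B}(\rho\otimes\tilde\rho)=\inf_{\epsilon>0}\limsup_{n\to\infty}\sup_{\Lambda_n\in\mathrm{CLODCC}(A:C:B),\ \alpha_m}\Big\{\frac mn:\big\|\mathrm{Tr}_C\Lambda_n\big((\rho_{AC_1}\otimes\tilde\rho_{C_2B})^{\otimes n}\big)-\alpha_m\big\|_1\le\epsilon\Big\}.$$ **Corollary.** Let $\rho=\rho_{AC_1}$ and $\tilde\rho=\tilde\rho_{C_2B}$ be bipartite states with $\rho^\Gamma\ge0$ and $\tilde\rho^\Gamma\ge0$. Then $$\mathcal R_A^{A\leftrightarrow C\leftrightarrow B}(\rho\otimes\tilde\rho)\le G(\rho^\Gamma\otimes\tilde\rho^\Gamma)=\log|AC_1C_2B|-S(\rho^\Gamma\otimes\tilde\rho^\Gamma),$$ and moreover $$G(\rho^\Gamma\otimes\tilde\rho^\Gamma)=D\Big(\rho^\Gamma\Big\|\frac{\mathbb I}{|AC_1|}\Big)+D\Big(\tilde\rho^\Gamma\Big\|\frac{\mathbb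 I}{|C_2B|}\Big).$$ -/

import Mathlib

open scoped Matrix Kronecker ComplexOrder

namespace PrivateRandomness

noncomputable section

/-! ### States, partial transposition, entropies, trace norm -/

/-- A density matrix: positive semidefinite with unit trace. -/
structure IsState {ι : Type*} [Fintype ι] (ρ : Matrix ι ι ℂ) : Prop where
  posSemidef : ρ.PosSemidef
  trace_eq_one : ρ.trace = 1

/-- The partial transposition `id ⊗ T` on the second tensor factor. -/
def partialTranspose {ι κ : Type*} (ρ : Matrix (ι × κ) (ι × κ) ℂ) :
    Matrix (ι × κ) (ι × κ) ℂ :=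
  Matrix.of fun x y => ρ (x.1, y.2) (y.1, x.2)

/-- Binary logarithm of a Hermitian matrix by functional calculus; the kernel is sent to zero,
which is the convention `0 log 0 = 0` in `Tr (ρ log ρ)`. -/
def matrixLog {ι : Type*} [Fintype ι] [DecidableEq ι] (ρ : Matrix ι ι ℂ) : Matrix ι ι ℂ :=
  cfc (Real.logb 2) ρ

/-- The von Neumann entropy `S(ρ) = -Tr (ρ log ρ)`. -/
def entropy {ι : Type*} [Fintype ι] [DecidableEq ι] (ρ : Matrix ι ι ℂ) : ℝ :=
  -(ρ * matrixLog ρ).trace.re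

/-- The global purity: the logarithm of the total dimension minus the entropy. -/
def globalPurity {ι : Type*} [Fintype ι] [DecidableEq ι] (ρ : Matrix ι ι ℂ) : ℝ :=
  Real.logb 2 (Fintype.card ι) - entropy ρ

open Classical in
/-- The quantum relative entropy `D(ρ‖σ) = Tr (ρ log ρ - ρ log σ)`, which is `+∞` unless the kernel
of `σ` is contained in the kernel of `ρ`. -/
def relEntropy {ι : Type*} [Fintype ι] [DecidableEq ι] (ρ σ : Matrix ι ι ℂ) : EReal :=
  if ∀ v : ι → ℂ, σ *ᵥ v = 0 → ρ *ᵥ v = 0 then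
    (((ρ * matrixLog ρ - ρ * matrixLog σ).trace.re : ℝ) : EReal)
  else ⊤

/-- The maximally mixed state. -/
def maximallyMixed (ι : Type*) [Fintype ι] [DecidableEq ι] : Matrix ι ι ℂ :=
  ((Fintype.card ι : ℂ)⁻¹) • (1 : Matrix ι ι ℂ)

/-- The trace norm `Tr |X|`, as the sum of the singular values of `X`. -/
def traceNorm {ι : Type*} [Fintype ι] [DecidableEq ι] (X : Matrix ι ι ℂ) : ℝ :=
  ∑ i, √((Matrix.isHermitian_conjTranspose_mul_self X).eigenvalues i)

/-! ### CLODCC operations of three parties `A`, `C`, `B` -/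

/-- Computational basis labels of a tripartite system in which `A`, `C`, `B` hold systems of
dimensions `a`, `c`, `b`. -/
abbrev Tri (a c b : ℕ) : Type := Fin a × Fin c × Fin b

/-- Linear maps from the operators on one tripartite system to those on another. -/
abbrev TriMap (a c b a' c' b' : ℕ) : Type :=
  Matrix (Tri a c b) (Tri a c b) ℂ →ₗ[ℂ] Matrix (Tri a' c' b') (Tri a' c' b') ℂ

/-- The map `M ↦ U M U†`. -/
def conjMap {ι : Type*} [Fintype ι] (U : Matrix ι ι ℂ) : Matrix ι ι ℂ →ₗ[ℂ] Matrix ι ι ℂ where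
  toFun M := U * M * Uᴴ
  map_add' M N := by rw [Matrix.mul_add, Matrix.add_mul]
  map_smul' r M := by simp

/-- Transmission through a dephasing channel. The basis label `x` after the transmission comes from
the label `old x` before it, and `msg x` is the label of the transmitted subsystem, which is
dephased in the computational basis: the coherences between different messages are erased. -/
def dephasingTransfer {ι κ σ : Type*} [DecidableEq σ] (old : κ → ι) (msg : κ → σ) :
    Matrix ι ι ℂ →ₗ[ℂ] Matrix κ κ ℂ where
  toFun M := Matrix.of fun x y => if msg x = msg y then M (old x) (old y) else 0
  map_add' M N := by
    ext x y
    by_cases h : msg x = msg y <;> simp [h]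
  map_smul' r M := by
    ext x y
    by_cases h : msg x = msg y <;> simp [h]

/-- The class `CLODCC(A:C:B)`: everything generated under composition by local unitaries and by
sending, from any party to any other party, a subsystem (of dimension `s`) through a dephasing
channel. A system of dimension `k * s` is read as the tensor product of systems of dimensions `k`
and `s`, where `(i, t)` has the label `i * s + t`; this is no restriction since every party may
first apply an arbitrary local unitary. Infinite compositions are covered by closing the class
under limits. -/
inductive CLODCC : {a c b a' c' b' : ℕ} → TriMap a c b a' c' b' → Prop
  | id {a c b : ℕ} : CLODCC (LinearMap.id : TriMap a c b a c b)
  | unitaryA {a c b : ℕ} (U : Matrix (Fin a) (Fin a) ℂ) (hU : U ∈ Matrix.unitaryGroup (Fin a) ℂ) :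
      CLODCC (conjMap (U ⊗ₖ ((1 : Matrix (Fin c) (Fin c) ℂ) ⊗ₖ (1 : Matrix (Fin b) (Fin b) ℂ))) :
        TriMap a c b a c b)
  | unitaryC {a c b : ℕ} (U : Matrix (Fin c) (Fin c) ℂ) (hU : U ∈ Matrix.unitaryGroup (Fin c) ℂ) :
      CLODCC (conjMap ((1 : Matrix (Fin a) (Fin a) ℂ) ⊗ₖ (U ⊗ₖ (1 : Matrix (Fin b) (Fin b) ℂ))) :
        TriMap a c b a c b)
  | unitaryB {a c b : ℕ} (U : Matrix (Fin b) (Fin b) ℂ) (hU : U ∈ Matrix.unitaryGroup (Fin b) ℂ) :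
      CLODCC (conjMap ((1 : Matrix (Fin a) (Fin a) ℂ) ⊗ₖ ((1 : Matrix (Fin c) (Fin c) ℂ) ⊗ₖ U)) :
        TriMap a c b a c b)
  | sendAC {a c b s : ℕ} :
      CLODCC (dephasingTransfer
        (fun x => (finProdFinEquiv (x.1, x.2.1.modNat), x.2.1.divNat, x.2.2))
        (fun x => x.2.1.modNat) : TriMap (a * s) c b a (c * s) b)
  | sendAB {a c b s : ℕ} :
      CLODCC (dephasingTransfer
        (fun x => (finProdFinEquiv (x.1, x.2.2.modNat), x.2.1, x.2.2.divNat))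
        (fun x => x.2.2.modNat) : TriMap (a * s) c b a c (b * s))
  | sendCA {a c b s : ℕ} :
      CLODCC (dephasingTransfer
        (fun x => (x.1.divNat, finProdFinEquiv (x.2.1, x.1.modNat), x.2.2))
        (fun x => x.1.modNat) : TriMap a (c * s) b (a * s) c b)
  | sendCB {a c b s : ℕ} :
      CLODCC (dephasingTransfer
        (fun x => (x.1, finProdFinEquiv (x.2.1, x.2.2.modNat), x.2.2.divNat))
        (fun x => x.2.2.modNat) : TriMap a (c * s) b a c (b * s))
  | sendBA {a c b s : ℕ} :
      CLODCC (dephasingTransfer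
        (fun x => (x.1.divNat, x.2.1, finProdFinEquiv (x.2.2, x.1.modNat)))
        (fun x => x.1.modNat) : TriMap a c (b * s) (a * s) c b)
  | sendBC {a c b s : ℕ} :
      CLODCC (dephasingTransfer
        (fun x => (x.1, x.2.1.divNat, finProdFinEquiv (x.2.2, x.2.1.modNat)))
        (fun x => x.2.1.modNat) : TriMap a c (b * s) a (c * s) b)
  | comp {a c b a' c' b' a'' c'' b'' : ℕ} {Λ : TriMap a c b a' c' b'}
      {Λ' : TriMap a' c' b' a'' c'' b''} (h : CLODCC Λ) (h' : CLODCC Λ') : CLODCC (Λ' ∘ₗ Λ)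
  | limit {a c b a' c' b' : ℕ} {Λs : ℕ → TriMap a c b a' c' b'} {Λ : TriMap a c b a' c' b'}
      (h : ∀ k, CLODCC (Λs k))
      (hlim : ∀ M, Filter.Tendsto (fun k => Λs k M) Filter.atTop (nhds (Λ M))) : CLODCC Λ

/-- The partial trace over the system of `C`. -/
def traceC {a c b : ℕ} (M : Matrix (Tri a c b) (Tri a c b) ℂ) :
    Matrix (Fin a × Fin b) (Fin a × Fin b) ℂ :=
  Matrix.of fun x y => ∑ z : Fin c, M (x.1, z, x.2) (y.1, z, y.2)

/-- `(ρ_{AC₁} ⊗ ρ̃_{C₂B})^{⊗ n}`, with the `n` copies of `A` held by `A`, the `n` copies of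
`C₁C₂` held by `C` and the `n` copies of `B` held by `B`. -/
def copies {a c₁ c₂ b : ℕ} (ρ : Matrix (Fin a × Fin c₁) (Fin a × Fin c₁) ℂ)
    (ρ' : Matrix (Fin c₂ × Fin b) (Fin c₂ × Fin b) ℂ) (n : ℕ) :
    Matrix (Tri (a ^ n) ((c₁ * c₂) ^ n) (b ^ n)) (Tri (a ^ n) ((c₁ * c₂) ^ n) (b ^ n)) ℂ :=
  Matrix.of fun x y => ∏ k : Fin n,
    (ρ (finFunctionFinEquiv.symm x.1 k, (finFunctionFinEquiv.symm x.2.1 k).divNat)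
        (finFunctionFinEquiv.symm y.1 k, (finFunctionFinEquiv.symm y.2.1 k).divNat) *
      ρ' ((finFunctionFinEquiv.symm x.2.1 k).modNat, finFunctionFinEquiv.symm x.2.2 k)
        ((finFunctionFinEquiv.symm y.2.1 k).modNat, finFunctionFinEquiv.symm y.2.2 k))

/-! ### Local independent states and the rate -/

/-- The projector onto the uniform superposition of the `d` computational basis vectors. -/
def plusProj (d : ℕ) : Matrix (Fin d) (Fin d) ℂ := Matrix.of fun _ _ => (d : ℂ)⁻¹

/-- The twisting `∑ i, |i⟩⟨i| ⊗ U i`. -/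
def twisting {d : ℕ} {κ : Type*} (U : Fin d → Matrix κ κ ℂ) :
    Matrix (Fin d × κ) (Fin d × κ) ℂ :=
  Matrix.of fun x y => if x.1 = y.1 then U x.1 x.2 y.2 else 0

/-- `α` is a local idit at the first party: its system is identified (through `e`) with `A A'`
where `A` has dimension `d`, the second party holds `B'`, and `α` is the twisting, controlled by
`A`, of `|+⟩⟨+|_A ⊗ σ_{A'B'}` for some state `σ`. Measuring `A` in the computational basis gives
`log₂ d` private random bits. -/
def IsLocalIdit (d : ℕ) {a b : ℕ} (α : Matrix (Fin a × Fin b) (Fin a × Fin b) ℂ) : Prop :=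
  0 < d ∧ ∃ (k : ℕ) (e : Fin a ≃ Fin d × Fin k)
    (U : Fin d → Matrix (Fin k × Fin b) (Fin k × Fin b) ℂ)
    (σ : Matrix (Fin k × Fin b) (Fin k × Fin b) ℂ),
    (∀ i, U i ∈ Matrix.unitaryGroup (Fin k × Fin b) ℂ) ∧ IsState σ ∧
    α = (twisting U * (plusProj d ⊗ₖ σ) * (twisting U)ᴴ).submatrix
      (fun x => ((e x.1).1, ((e x.1).2, x.2))) (fun x => ((e x.1).1, ((e x.1).2, x.2)))

/-- The numbers `m / n` such that some CLODCC operation on `n` copies, followed by the trace over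
`C`, gives a state that is `ε`-close in trace norm to a local idit at `A` with `m = log₂ d` private
random bits. -/
def achievable {a c₁ c₂ b : ℕ} (ρ : Matrix (Fin a × Fin c₁) (Fin a × Fin c₁) ℂ)
    (ρ' : Matrix (Fin c₂ × Fin b) (Fin c₂ × Fin b) ℂ) (ε : ℝ) (n : ℕ) : Set EReal :=
  {r | ∃ (d oa oc ob : ℕ) (Λ : TriMap (a ^ n) ((c₁ * c₂) ^ n) (b ^ n) oa oc ob)
      (α : Matrix (Fin oa × Fin ob) (Fin oa × Fin ob) ℂ),
    CLODCC Λ ∧ IsLocalIdit d α ∧ traceNorm (traceC (Λ (copies ρ ρ' n)) - α) ≤ ε ∧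
    r = ((Real.logb 2 d / n : ℝ) : EReal)}

/-- The quantum private randomness repeater rate at `A`. -/
def repeaterRate {a c₁ c₂ b : ℕ} (ρ : Matrix (Fin a × Fin c₁) (Fin a × Fin c₁) ℂ)
    (ρ' : Matrix (Fin c₂ × Fin b) (Fin c₂ × Fin b) ℂ) : EReal :=
  ⨅ (ε : ℝ) (_ : 0 < ε), Filter.limsup (fun n : ℕ => sSup (achievable ρ ρ' ε n)) Filter.atTop

end

end PrivateRandomness

/-! Let `Γ` be the transposition of `C`. A dephased message is classical, so sending it commutes
with `Γ`, and a unitary of `C` only becomes its complex conjugate. Hence `Γ ∘ Λ ∘ Γ` is positive,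
unital and trace preserving for every CLODCC map `Λ` (`CLODCC.isPPTBistochastic`); positivity is all
that is needed, not complete positivity. By the PPT hypotheses it acts on a genuine state `τ`, the
`Γ`-transposed input, and the trace over `C` cannot see the `Γ` at the output.

An idit with `d` values passes a projective test of relative rank `1 / d` with certainty
(`IsLocalIdit.exists_projection`). Pulled back along the protocol, the test is a functional `φ`
between `0` and the trace with `φ 1 = N / d`, where `N` is the total dimension, and `φ τ ≥ 1 - ε` if
the output is `ε`-close to the idit. Such a test forces `(1 - ε) log d - 1 ≤ G(τ)`
(`IsState.mul_logb_sub_one_le_globalPurity`), by Gibbs' inequality for the spectrum of `τ`. Purity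
is additive, so for `n` copies the right side is `n` times the claimed bound; divide by `n`, then
let `n → ∞` and `ε → 0`. -/

namespace PrivateRandomness

/-! ### States and tensor powers -/

section State

variable {ι κ : Type*} [Fintype ι] [Fintype κ]

theorem IsState.nonempty {M : Matrix ι ι ℂ} (h : IsState M) : Nonempty ι := by
  by_contra hn
  rw [not_nonempty_iff] at hn
  have := h.trace_eq_one
  simp [Matrix.trace] at this

theorem IsState.kronecker {M : Matrix ι ι ℂ} {N : Matrix κ κ ℂ} (hM : IsState M)
    (hN : IsState N) : IsState (M ⊗ₖ N) :=
  ⟨hM.posSemidef.kronecker hN.posSemidef, by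
    rw [Matrix.trace_kronecker, hM.trace_eq_one, hN.trace_eq_one, one_mul]⟩

theorem IsState.transpose {M : Matrix ι ι ℂ} (hM : IsState M) : IsState Mᵀ :=
  ⟨hM.posSemidef.transpose, by rw [Matrix.trace_transpose, hM.trace_eq_one]⟩

theorem IsState.submatrix_equiv {M : Matrix ι ι ℂ} (hM : IsState M) (e : κ ≃ ι) :
    IsState (M.submatrix e e) :=
  ⟨hM.posSemidef.submatrix e, by
    rw [← hM.trace_eq_one]
    exact e.sum_comp fun i => M i i⟩

theorem IsState.partialTranspose {M : Matrix (ι × κ) (ι × κ) ℂ} (h : IsState M)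
    (hppt : (PrivateRandomness.partialTranspose M).PosSemidef) :
    IsState (PrivateRandomness.partialTranspose M) :=
  ⟨hppt, h.trace_eq_one⟩

end State

/-- The tensor power `M^{⊗ n}`. -/
def tensorPower {ι : Type*} (M : Matrix ι ι ℂ) (n : ℕ) : Matrix (Fin n → ι) (Fin n → ι) ℂ :=
  Matrix.of fun x y => ∏ k, M (x k) (y k)

theorem tensorPower_succ {ι : Type*} (M : Matrix ι ι ℂ) (n : ℕ) :
    tensorPower M (n + 1) = (M ⊗ₖ tensorPower M n).submatrix
      (Fin.consEquiv fun _ => ι).symm (Fin.consEquiv fun _ => ι).symm := by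
  ext x y
  simp only [tensorPower, Matrix.of_apply, Fin.prod_univ_succ]
  rfl

theorem tensorPower_zero {ι : Type*} [DecidableEq ι] (M : Matrix ι ι ℂ) : tensorPower M 0 = 1 := by
  ext x y
  obtain rfl := Subsingleton.elim x y
  simp [tensorPower]

/-! ### Entropy and global purity -/

section Entropy

variable {ι κ : Type*} [Fintype ι] [DecidableEq ι] [Fintype κ] [DecidableEq κ]

theorem exists_unitary_diagonalization {M : Matrix ι ι ℂ} (hM : M.IsHermitian) :
    ∃ V ∈ Matrix.unitaryGroup ι ℂ,
      M = V * Matrix.diagonal (fun i => (hM.eigenvalues i : ℂ)) * Vᴴ := by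
  refine ⟨hM.eigenvectorUnitary, hM.eigenvectorUnitary.2, ?_⟩
  conv_lhs => rw [hM.spectral_theorem, Unitary.conjStarAlgAut_apply]
  rfl

theorem isHermitian_conj_diagonal (V : Matrix ι ι ℂ) (t : ι → ℝ) :
    (V * Matrix.diagonal (fun i => (t i : ℂ)) * Vᴴ).IsHermitian := by
  apply Matrix.isHermitian_mul_mul_conjTranspose
  rw [Matrix.isHermitian_diagonal_iff]
  intro i
  simp [IsSelfAdjoint]

theorem charpoly_conj_diagonal {V : Matrix ι ι ℂ} (hV : V ∈ Matrix.unitaryGroup ι ℂ)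
    (t : ι → ℝ) :
    (V * Matrix.diagonal (fun i => (t i : ℂ)) * Vᴴ).charpoly =
      ∏ i, (Polynomial.X - Polynomial.C (t i : ℂ)) := by
  have h : Vᴴ * V = 1 := Matrix.mem_unitaryGroup_iff'.1 hV
  rw [Matrix.charpoly_mul_comm, ← mul_assoc, h, one_mul, Matrix.charpoly_diagonal]

/-- The trace of `f(M)` depends only on the multiset of eigenvalues, that is, on the roots of the
characteristic polynomial. Entropies can thus be compared without matching the orderings of the
eigenvalues. -/
theorem trace_cfc_of_charpoly {M : Matrix ι ι ℂ} (hM : M.IsHermitian) {t : ι → ℝ}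
    (hcp : M.charpoly = ∏ i, (Polynomial.X - Polynomial.C (t i : ℂ))) (f : ℝ → ℝ) :
    (cfc f M).trace = ((∑ i, f (t i) : ℝ) : ℂ) := by
  have h1 : (cfc f M).trace = ((∑ i, f (hM.eigenvalues i) : ℝ) : ℂ) := by
    rw [Matrix.IsHermitian.cfc_eq hM, Matrix.IsHermitian.cfc, Unitary.conjStarAlgAut_apply,
      Matrix.trace_mul_comm, ← mul_assoc]
    simp [Matrix.trace_diagonal]
  have h2 : (Finset.univ.val.map fun i => hM.eigenvalues i) = Finset.univ.val.map t := by
    have h := congrArg Polynomial.roots (hM.charpoly_eq.symm.trans hcp)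
    have hroots : ∀ r : ι → ℝ, (∏ i, (Polynomial.X - Polynomial.C (r i : ℂ))).roots =
        (Finset.univ.val.map r).map Complex.ofReal := by
      intro r
      rw [Multiset.map_map, ← Polynomial.roots_multiset_prod_X_sub_C
        (Finset.univ.val.map (Complex.ofReal ∘ r)), Multiset.map_map]
      rfl
    rw [← Multiset.map_injective Complex.ofReal_injective |>.eq_iff, ← hroots, ← hroots]
    exact h
  have h3 := congrArg (fun s => (s.map f).sum) h2
  simp only [Multiset.map_map] at h3
  rw [h1]
  exact congrArg Complex.ofReal h3

theorem mul_matrixLog {M : Matrix ι ι ℂ} (hM : M.IsHermitian) :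
    M * matrixLog M = cfc (fun x => x * Real.logb 2 x) M := by
  -- Every function is continuous on a finite spectrum, so the singularity of the logarithm at `0`
  -- is harmless.
  have hfin : (spectrum ℝ M).Finite := Matrix.finite_real_spectrum
  rw [cfc_mul (fun x => x) (Real.logb 2) M continuousOn_id
    (hfin.continuousOn _), cfc_id' ℝ M]
  rfl

theorem entropy_of_charpoly {M : Matrix ι ι ℂ} (hM : M.IsHermitian) {t : ι → ℝ}
    (hcp : M.charpoly = ∏ i, (Polynomial.X - Polynomial.C (t i : ℂ))) :
    entropy M = -∑ i, t i * Real.logb 2 (t i) := by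
  rw [entropy, mul_matrixLog hM, trace_cfc_of_charpoly hM hcp]
  simp

theorem entropy_conj_diagonal {V : Matrix ι ι ℂ} (hV : V ∈ Matrix.unitaryGroup ι ℂ)
    (t : ι → ℝ) :
    entropy (V * Matrix.diagonal (fun i => (t i : ℂ)) * Vᴴ) = -∑ i, t i * Real.logb 2 (t i) :=
  entropy_of_charpoly (isHermitian_conj_diagonal V t) (charpoly_conj_diagonal hV t)

theorem entropy_transpose {M : Matrix ι ι ℂ} (hM : M.IsHermitian) : entropy Mᵀ = entropy M := by
  rw [entropy_of_charpoly hM hM.charpoly_eq, entropy_of_charpoly hM.transpose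
    ((Matrix.charpoly_transpose M).trans hM.charpoly_eq)]

theorem entropy_submatrix_equiv {M : Matrix ι ι ℂ} (hM : M.IsHermitian) (e : κ ≃ ι) :
    entropy (M.submatrix e e) = entropy M := by
  have h : (M.submatrix e e).charpoly =
      ∏ k, (Polynomial.X - Polynomial.C (hM.eigenvalues (e k) : ℂ)) := by
    have h1 := Matrix.charpoly_reindex e.symm M
    rw [Matrix.reindex_apply, Equiv.symm_symm] at h1
    rw [h1, hM.charpoly_eq]
    exact (e.prod_comp fun i => Polynomial.X - Polynomial.C (hM.eigenvalues i : ℂ)).symm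
  rw [entropy_of_charpoly (hM.submatrix e) h, entropy_of_charpoly hM hM.charpoly_eq]
  congr 1
  exact e.sum_comp fun i => hM.eigenvalues i * Real.logb 2 (hM.eigenvalues i)

theorem IsState.sum_eigenvalues {M : Matrix ι ι ℂ} (h : IsState M) :
    ∑ i, h.posSemidef.isHermitian.eigenvalues i = 1 := by
  have := h.posSemidef.isHermitian.trace_eq_sum_eigenvalues
  rw [h.trace_eq_one] at this
  apply Complex.ofReal_injective
  rw [Complex.ofReal_sum]
  simpa using this.symm

theorem entropy_kronecker {M : Matrix ι ι ℂ} {N : Matrix κ κ ℂ} (hM : IsState M)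
    (hN : IsState N) : entropy (M ⊗ₖ N) = entropy M + entropy N := by
  obtain ⟨V, hV, hVM⟩ := exists_unitary_diagonalization hM.posSemidef.isHermitian
  obtain ⟨W, hW, hWN⟩ := exists_unitary_diagonalization hN.posSemidef.isHermitian
  have hs := hM.sum_eigenvalues
  have ht := hN.sum_eigenvalues
  have hs0 := hM.posSemidef.eigenvalues_nonneg
  have ht0 := hN.posSemidef.eigenvalues_nonneg
  generalize hM.posSemidef.isHermitian.eigenvalues = s at *
  generalize hN.posSemidef.isHermitian.eigenvalues = t at *
  have hVW : V ⊗ₖ W ∈ Matrix.unitaryGroup (ι × κ) ℂ := Matrix.kronecker_mem_unitary hV hW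
  have key : M ⊗ₖ N = (V ⊗ₖ W) *
      Matrix.diagonal (fun i : ι × κ => ((s i.1 * t i.2 : ℝ) : ℂ)) * (V ⊗ₖ W)ᴴ := by
    rw [hVM, hWN, Matrix.conjTranspose_kronecker, Matrix.mul_kronecker_mul,
      Matrix.mul_kronecker_mul, Matrix.diagonal_kronecker_diagonal]
    simp
  have hlog : ∀ i j, s i * t j * Real.logb 2 (s i * t j) =
      s i * Real.logb 2 (s i) * t j + s i * (t j * Real.logb 2 (t j)) := by
    intro i j
    rcases (hs0 i).eq_or_lt with h | h
    · simp [← h]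
    rcases (ht0 j).eq_or_lt with h' | h'
    · simp [← h']
    rw [Real.logb_mul h.ne' h'.ne']
    ring
  rw [key, entropy_conj_diagonal hVW, hVM, hWN, entropy_conj_diagonal hV,
    entropy_conj_diagonal hW, Fintype.sum_prod_type]
  simp only [hlog, Finset.sum_add_distrib, ← Finset.mul_sum, ← Finset.sum_mul, hs, ht]
  ring

theorem relEntropy_maximallyMixed {M : Matrix ι ι ℂ} (h : IsState M) :
    relEntropy M (maximallyMixed ι) = (globalPurity M : EReal) := by
  have := h.nonempty
  have hc : (Fintype.card ι : ℂ) ≠ 0 := by simp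
  have hlog : matrixLog (maximallyMixed ι) =
      ((-Real.logb 2 (Fintype.card ι) : ℝ) : ℂ) • (1 : Matrix ι ι ℂ) := by
    have h1 : maximallyMixed ι = algebraMap ℝ (Matrix ι ι ℂ) ((Fintype.card ι : ℝ)⁻¹) := by
      ext i j
      simp [maximallyMixed, Matrix.algebraMap_matrix_apply, Matrix.one_apply]
    rw [matrixLog, h1, cfc_algebraMap, Real.logb_inv]
    ext i j
    simp [Matrix.algebraMap_matrix_apply, Matrix.one_apply]
  rw [relEntropy, if_pos, hlog, globalPurity, entropy]
  · congr 1
    rw [Matrix.trace_sub, Matrix.mul_smul, Matrix.trace_smul, mul_one, h.trace_eq_one]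
    simp only [Complex.sub_re, smul_eq_mul, mul_one, Complex.ofReal_re]
    ring
  · intro v hv
    rw [maximallyMixed, Matrix.smul_mulVec, Matrix.one_mulVec, smul_eq_zero] at hv
    rcases hv with hv | hv
    · exact absurd hv (inv_ne_zero hc)
    · simp [hv]

theorem globalPurity_kronecker {M : Matrix ι ι ℂ} {N : Matrix κ κ ℂ} (hM : IsState M)
    (hN : IsState N) : globalPurity (M ⊗ₖ N) = globalPurity M + globalPurity N := by
  have := hM.nonempty
  have := hN.nonempty
  rw [globalPurity, globalPurity, globalPurity, entropy_kronecker hM hN, Fintype.card_prod,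
    Nat.cast_mul, Real.logb_mul (by simp) (by simp)]
  ring

theorem globalPurity_transpose {M : Matrix ι ι ℂ} (hM : M.IsHermitian) :
    globalPurity Mᵀ = globalPurity M := by
  rw [globalPurity, globalPurity, entropy_transpose hM]

theorem globalPurity_submatrix_equiv {M : Matrix ι ι ℂ} (hM : M.IsHermitian) (e : κ ≃ ι) :
    globalPurity (M.submatrix e e) = globalPurity M := by
  rw [globalPurity, globalPurity, entropy_submatrix_equiv hM, Fintype.card_congr e]

theorem IsState.tensorPower {M : Matrix ι ι ℂ} (hM : IsState M) (n : ℕ) :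
    IsState (tensorPower M n) := by
  induction n with
  | zero =>
    rw [tensorPower_zero]
    exact ⟨Matrix.PosSemidef.one, by simp⟩
  | succ n ih =>
    rw [tensorPower_succ]
    exact (hM.kronecker ih).submatrix_equiv _

theorem globalPurity_tensorPower {M : Matrix ι ι ℂ} (hM : IsState M) (n : ℕ) :
    globalPurity (tensorPower M n) = n * globalPurity M := by
  induction n with
  | zero =>
    rw [tensorPower_zero, globalPurity, entropy_of_charpoly (t := fun _ => 1)
      Matrix.isHermitian_one (by simp [Matrix.charpoly_one])]
    simp
  | succ n ih =>
    rw [tensorPower_succ, globalPurity_submatrix_equiv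
      (hM.kronecker (hM.tensorPower n)).posSemidef.isHermitian,
      globalPurity_kronecker hM (hM.tensorPower n), ih]
    push_cast
    ring

end Entropy

/-! ### CLODCC maps conjugated by the transposition of `C` -/

/-- The partial transposition on the system of `C`. -/
def transposeC {a c b : ℕ} (M : Matrix (Tri a c b) (Tri a c b) ℂ) :
    Matrix (Tri a c b) (Tri a c b) ℂ :=
  Matrix.of fun x y => M (x.1, y.2.1, x.2.2) (y.1, x.2.1, y.2.2)

/-- Trace preserving unital maps that remain positive after conjugation with the partial
transposition on `C`. -/
structure IsPPTBistochastic {a c b a' c' b' : ℕ} (Λ : TriMap a c b a' c' b') : Prop where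
  map_one : Λ 1 = 1
  trace_map : ∀ M, (Λ M).trace = M.trace
  posSemidef_map : ∀ M, (transposeC M).PosSemidef → (transposeC (Λ M)).PosSemidef

theorem transposeC_transposeC {a c b : ℕ} (M : Matrix (Tri a c b) (Tri a c b) ℂ) :
    transposeC (transposeC M) = M := rfl

theorem transposeC_conj_kronecker {a c b : ℕ} (A : Matrix (Fin a) (Fin a) ℂ)
    (C : Matrix (Fin c) (Fin c) ℂ) (B : Matrix (Fin b) (Fin b) ℂ)
    (M : Matrix (Tri a c b) (Tri a c b) ℂ) :
    transposeC ((A ⊗ₖ (C ⊗ₖ B)) * M * (A ⊗ₖ (C ⊗ₖ B))ᴴ) =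
      (A ⊗ₖ (C.map star ⊗ₖ B)) * transposeC M * (A ⊗ₖ (C.map star ⊗ₖ B))ᴴ := by
  ext x y
  simp only [transposeC, Matrix.of_apply, Matrix.mul_apply, Matrix.conjTranspose_apply,
    Matrix.kroneckerMap_apply, Matrix.map_apply, Finset.sum_mul]
  rw [← Fintype.sum_prod_type', ← Fintype.sum_prod_type']
  -- The two sums agree after exchanging the `C`-components of the two summation indices.
  let e : Tri a c b × Tri a c b ≃ Tri a c b × Tri a c b :=
    { toFun := fun p => ((p.1.1, p.2.2.1, p.1.2.2), (p.2.1, p.1.2.1, p.2.2.2))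
      invFun := fun p => ((p.1.1, p.2.2.1, p.1.2.2), (p.2.1, p.1.2.1, p.2.2.2))
      left_inv := fun _ => rfl
      right_inv := fun _ => rfl }
  refine Fintype.sum_equiv e _ _ fun p => ?_
  simp only [e, Equiv.coe_fn_mk, star_mul', star_star]
  ring

theorem IsPPTBistochastic.conjMap_kronecker {a c b : ℕ} {A : Matrix (Fin a) (Fin a) ℂ}
    {C : Matrix (Fin c) (Fin c) ℂ} {B : Matrix (Fin b) (Fin b) ℂ}
    (hA : A ∈ Matrix.unitaryGroup (Fin a) ℂ) (hC : C ∈ Matrix.unitaryGroup (Fin c) ℂ)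
    (hB : B ∈ Matrix.unitaryGroup (Fin b) ℂ) :
    IsPPTBistochastic (conjMap (A ⊗ₖ (C ⊗ₖ B)) : TriMap a c b a c b) := by
  have hU : A ⊗ₖ (C ⊗ₖ B) ∈ Matrix.unitaryGroup (Tri a c b) ℂ :=
    Matrix.kronecker_mem_unitary hA (Matrix.kronecker_mem_unitary hC hB)
  refine ⟨?_, fun M => ?_, fun M hM => ?_⟩
  · have h := Matrix.mem_unitaryGroup_iff.1 hU
    rw [Matrix.star_eq_conjTranspose] at h
    simp only [conjMap, LinearMap.coe_mk, AddHom.coe_mk, mul_one, h]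
  · have h := Matrix.mem_unitaryGroup_iff'.1 hU
    rw [Matrix.star_eq_conjTranspose] at h
    simp only [conjMap, LinearMap.coe_mk, AddHom.coe_mk]
    rw [Matrix.trace_mul_comm, ← mul_assoc, h, one_mul]
  · simp only [conjMap, LinearMap.coe_mk, AddHom.coe_mk]
    rw [transposeC_conj_kronecker]
    exact hM.mul_mul_conjTranspose_same _

/-- Dephasing is a sum over the messages `s` of compressions by the projection onto the labels with
message `s`. -/
theorem posSemidef_dephasingTransfer {ι κ σ : Type*} [Fintype ι] [Fintype κ] [Fintype σ]
    [DecidableEq σ] [DecidableEq κ] (old : κ → ι) (msg : κ → σ) {M : Matrix ι ι ℂ}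
    (hM : M.PosSemidef) : (dephasingTransfer old msg M).PosSemidef := by
  have h : dephasingTransfer old msg M = ∑ s : σ,
      Matrix.diagonal (fun x => if msg x = s then (1 : ℂ) else 0) * M.submatrix old old *
        (Matrix.diagonal (fun x => if msg x = s then (1 : ℂ) else 0))ᴴ := by
    ext x y
    simp only [dephasingTransfer, LinearMap.coe_mk, AddHom.coe_mk, Matrix.of_apply,
      Matrix.sum_apply, Matrix.diagonal_conjTranspose, Matrix.mul_diagonal,
      Matrix.diagonal_mul, Matrix.submatrix_apply, Pi.star_apply, apply_ite star, star_one,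
      star_zero, ite_mul, one_mul, zero_mul, mul_ite, mul_one, mul_zero]
    simp [eq_comm]
  rw [h]
  exact Matrix.posSemidef_sum _ fun s _ => (hM.submatrix old).mul_mul_conjTranspose_same _

/-- `hmsg` and `hold` make the transfer commute with `transposeC`: on the surviving entries both
labels carry the same message, so it does not matter whether `C` holds it before or after the
transfer. `hinj` gives unitality, and with `hcard` the bijectivity behind trace preservation. -/
theorem IsPPTBistochastic.dephasingTransfer {a c b a' c' b' : ℕ} {σ : Type*} [Fintype σ]
    [DecidableEq σ] {old : Tri a' c' b' → Tri a c b} {msg : Tri a' c' b' → σ}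
    (hinj : Function.Injective old) (hcard : a' * (c' * b') = a * (c * b))
    (hmsg : ∀ x y : Tri a' c' b',
      msg (x.1, y.2.1, x.2.2) = msg (y.1, x.2.1, y.2.2) ↔ msg x = msg y)
    (hold : ∀ x y : Tri a' c' b', msg x = msg y →
      old (x.1, y.2.1, x.2.2) = ((old x).1, (old y).2.1, (old x).2.2)) :
    IsPPTBistochastic (PrivateRandomness.dephasingTransfer old msg :
      TriMap a c b a' c' b') := by
  have hbij : Function.Bijective old :=
    (Fintype.bijective_iff_injective_and_card old).2 ⟨hinj, by simpa using hcard⟩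
  refine ⟨?_, fun M => ?_, fun M hM => ?_⟩
  · ext x y
    simp only [PrivateRandomness.dephasingTransfer, LinearMap.coe_mk, AddHom.coe_mk,
      Matrix.of_apply, Matrix.one_apply, hinj.eq_iff]
    by_cases h : x = y <;> simp [h]
  · simp only [PrivateRandomness.dephasingTransfer, LinearMap.coe_mk, AddHom.coe_mk,
      Matrix.trace, Matrix.diag_apply, Matrix.of_apply, if_true]
    exact hbij.sum_comp fun z => M z z
  · have h : transposeC (PrivateRandomness.dephasingTransfer old msg M) =
        PrivateRandomness.dephasingTransfer old msg (transposeC M) := by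
      ext x y
      simp only [PrivateRandomness.dephasingTransfer, LinearMap.coe_mk, AddHom.coe_mk,
        Matrix.of_apply, transposeC, hmsg]
      by_cases h : msg x = msg y
      · rw [if_pos h, if_pos h, hold x y h, hold y x h.symm]
      · rw [if_neg h, if_neg h]
    rw [h]
    exact posSemidef_dephasingTransfer old msg hM

theorem finProd_injective {k s : ℕ} {x y : Fin (k * s)} (h₁ : x.divNat = y.divNat)
    (h₂ : x.modNat = y.modNat) : x = y :=
  finProdFinEquiv.symm.injective (Prod.ext h₁ h₂)

theorem isClosed_posSemidef {ι : Type*} [Fintype ι] :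
    IsClosed {M : Matrix ι ι ℂ | M.PosSemidef} := by
  simp only [Matrix.posSemidef_iff_dotProduct_mulVec, Set.ofPred_and, Set.ofPred_forall]
  refine IsClosed.inter ?_ (isClosed_iInter fun x => ?_)
  · exact isClosed_eq (by fun_prop) continuous_id
  · exact isClosed_le continuous_const (by fun_prop)

/-- All three conditions are closed under pointwise convergence. -/
theorem IsPPTBistochastic.limit {a c b a' c' b' : ℕ} {Λs : ℕ → TriMap a c b a' c' b'}
    {Λ : TriMap a c b a' c' b'} (h : ∀ k, IsPPTBistochastic (Λs k))
    (hlim : ∀ M, Filter.Tendsto (fun k => Λs k M) Filter.atTop (nhds (Λ M))) :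
    IsPPTBistochastic Λ := by
  refine ⟨?_, fun M => ?_, fun M hM => ?_⟩
  · refine tendsto_nhds_unique (hlim 1) ?_
    simp only [(h _).map_one, tendsto_const_nhds]
  · have h1 : Filter.Tendsto (fun k => (Λs k M).trace) Filter.atTop (nhds (Λ M).trace) :=
      ((continuous_id.matrix_trace).tendsto _).comp (hlim M)
    simp only [(h _).trace_map] at h1
    exact (tendsto_nhds_unique h1 tendsto_const_nhds)
  · have hc : Continuous (transposeC : Matrix (Tri a' c' b') (Tri a' c' b') ℂ → _) := by
      unfold transposeC
      fun_prop
    exact isClosed_posSemidef.mem_of_tendsto ((hc.tendsto _).comp (hlim M))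
      (Filter.Eventually.of_forall fun k => (h k).posSemidef_map M hM)

theorem CLODCC.isPPTBistochastic {a c b a' c' b' : ℕ} {Λ : TriMap a c b a' c' b'}
    (hΛ : CLODCC Λ) : IsPPTBistochastic Λ := by
  induction hΛ with
  | id => exact ⟨rfl, fun _ => rfl, fun _ h => h⟩
  | unitaryA U hU => exact .conjMap_kronecker hU (one_mem _) (one_mem _)
  | unitaryC U hU => exact .conjMap_kronecker (one_mem _) hU (one_mem _)
  | unitaryB U hU => exact .conjMap_kronecker (one_mem _) (one_mem _) hU
  | comp h h' ih ih' =>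
    refine ⟨?_, fun M => ?_, fun M hM => ?_⟩
    · rw [LinearMap.comp_apply, ih.map_one, ih'.map_one]
    · rw [LinearMap.comp_apply, ih'.trace_map, ih.trace_map]
    · exact ih'.posSemidef_map _ (ih.posSemidef_map _ hM)
  | limit h hlim ih => exact .limit ih hlim
  | sendAC =>
    refine .dephasingTransfer (fun x y hxy => ?_) (by ring) (fun x y => ?_) fun x y h => ?_
    · simp only [Prod.mk.injEq, EmbeddingLike.apply_eq_iff_eq] at hxy
      exact Prod.ext hxy.1.1 (Prod.ext (finProd_injective hxy.2.1 hxy.1.2) hxy.2.2)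
    -- When `C` is the recipient, exchanging the `C`-labels exchanges the two messages.
    · exact eq_comm
    · simp only [h]
  | sendAB =>
    refine .dephasingTransfer (fun x y hxy => ?_) (by ring) (fun x y => ?_) fun x y h => ?_
    · simp only [Prod.mk.injEq, EmbeddingLike.apply_eq_iff_eq] at hxy
      exact Prod.ext hxy.1.1 (Prod.ext hxy.2.1 (finProd_injective hxy.2.2 hxy.1.2))
    · exact Iff.rfl
    · rfl
  | sendCA =>
    refine .dephasingTransfer (fun x y hxy => ?_) (by ring) (fun x y => ?_) fun x y h => ?_
    · simp only [Prod.mk.injEq, EmbeddingLike.apply_eq_iff_eq] at hxy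
      exact Prod.ext (finProd_injective hxy.1 hxy.2.1.2) (Prod.ext hxy.2.1.1 hxy.2.2)
    · exact Iff.rfl
    · simp only [h]
  | sendCB =>
    refine .dephasingTransfer (fun x y hxy => ?_) (by ring) (fun x y => ?_) fun x y h => ?_
    · simp only [Prod.mk.injEq, EmbeddingLike.apply_eq_iff_eq] at hxy
      exact Prod.ext hxy.1 (Prod.ext hxy.2.1.1 (finProd_injective hxy.2.2 hxy.2.1.2))
    · exact Iff.rfl
    · simp only [h]
  | sendBA =>
    refine .dephasingTransfer (fun x y hxy => ?_) (by ring) (fun x y => ?_) fun x y h => ?_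
    · simp only [Prod.mk.injEq, EmbeddingLike.apply_eq_iff_eq] at hxy
      exact Prod.ext (finProd_injective hxy.1 hxy.2.2.2) (Prod.ext hxy.2.1 hxy.2.2.1)
    · exact Iff.rfl
    · rfl
  | sendBC =>
    refine .dephasingTransfer (fun x y hxy => ?_) (by ring) (fun x y => ?_) fun x y h => ?_
    · simp only [Prod.mk.injEq, EmbeddingLike.apply_eq_iff_eq] at hxy
      exact Prod.ext hxy.1 (Prod.ext (finProd_injective hxy.2.1 hxy.2.2.2) hxy.2.2.1)
    · exact eq_comm
    · simp only [h]

/-! ### A lower bound on purity from a test -/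

section Purity

/-- Gibbs' inequality for the weights `(d eᵢ + 1) / (2 N)`. -/
theorem sum_mul_logb_le {ι : Type*} [Fintype ι] [Nonempty ι] {t e : ι → ℝ} {d : ℝ}
    (ht : ∀ i, 0 ≤ t i) (hts : ∑ i, t i = 1) (he : ∀ i, 0 ≤ e i) (he' : ∀ i, e i ≤ 1)
    (hd : 1 ≤ d) (hde : d * ∑ i, e i = Fintype.card ι) :
    (∑ i, t i * e i) * Real.logb 2 d - 1 ≤
      Real.logb 2 (Fintype.card ι) + ∑ i, t i * Real.logb 2 (t i) := by
  set N : ℝ := (Fintype.card ι : ℝ) with hN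
  have hN0 : 0 < N := by simp [hN, Fintype.card_pos]
  have hd0 : 0 < d := by linarith
  have hln2 : 0 < Real.log 2 := Real.log_pos one_lt_two
  set q : ι → ℝ := fun i => (d * e i + 1) / (2 * N) with hq
  have hq0 : ∀ i, 0 < q i := fun i => by
    have := mul_nonneg hd0.le (he i)
    simp only [hq]
    positivity
  have hqs : ∑ i, q i = 1 := by
    simp only [hq, ← Finset.sum_div, Finset.sum_add_distrib, ← Finset.mul_sum, hde]
    simp only [Finset.sum_const, Finset.card_univ, nsmul_eq_mul, mul_one, ← hN]
    field_simp
    ring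
  have hlogq : ∀ i, e i * Real.log d - Real.log 2 - Real.log N ≤ Real.log (q i) := by
    intro i
    have h1 : Real.log (q i) = Real.log (d * e i + 1) - Real.log 2 - Real.log N := by
      have := mul_nonneg hd0.le (he i)
      rw [Real.log_div (by positivity) (by positivity), Real.log_mul two_ne_zero hN0.ne']
      ring
    -- Weighted AM-GM for `d` and `1` with weights `eᵢ` and `1 - eᵢ`.
    have h2 : d ^ e i ≤ d * e i + 1 := by
      have := Real.geom_mean_le_arith_mean2_weighted (he i) (sub_nonneg.2 (he' i)) hd0.le
        zero_le_one (by ring)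
      rw [Real.one_rpow, mul_one, mul_one] at this
      linarith [he i]
    have h3 := Real.log_le_log (Real.rpow_pos_of_pos hd0 _) h2
    rw [Real.log_rpow hd0] at h3
    linarith
  -- Termwise Gibbs from `log x ≤ x - 1` at `x = qᵢ / tᵢ`; the corrections `tᵢ - qᵢ` sum to zero.
  have hterm : ∀ i, t i * (e i * Real.log d - Real.log 2 - Real.log N) + (t i - q i) ≤
      t i * Real.log (t i) := by
    intro i
    rcases (ht i).eq_or_lt with h | h
    · simp only [← h]
      linarith [hq0 i]
    have h1 := Real.log_le_sub_one_of_pos (div_pos (hq0 i) h)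
    rw [Real.log_div (hq0 i).ne' h.ne'] at h1
    have h2 := mul_le_mul_of_nonneg_left h1 h.le
    have h3 : t i * (q i / t i - 1) = q i - t i := by field_simp
    have h4 := mul_le_mul_of_nonneg_left (hlogq i) h.le
    linarith
  have hsum := Finset.sum_le_sum fun i (_ : i ∈ Finset.univ) => hterm i
  have hlhs : ∑ i, (t i * (e i * Real.log d - Real.log 2 - Real.log N) + (t i - q i)) =
      (∑ i, t i * e i) * Real.log d - Real.log 2 - Real.log N := by
    have : ∀ i, t i * (e i * Real.log d - Real.log 2 - Real.log N) + (t i - q i) =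
        t i * e i * Real.log d - t i * (Real.log 2 + Real.log N) + (t i - q i) := fun i => by ring
    simp only [this, Finset.sum_add_distrib, Finset.sum_sub_distrib, ← Finset.sum_mul, hts, hqs]
    ring
  rw [hlhs] at hsum
  simp only [Real.logb, ← mul_div_assoc, ← Finset.sum_div]
  rw [← add_div, div_sub_one hln2.ne', div_le_div_iff_of_pos_right hln2]
  linarith

theorem IsState.mul_logb_sub_one_le_globalPurity {ι : Type*} [Fintype ι] [DecidableEq ι]
    {τ : Matrix ι ι ℂ} (hτ : IsState τ) (φ : Matrix ι ι ℂ →ₗ[ℂ] ℂ) {d : ℕ} (hd : 0 < d)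
    (hφ0 : ∀ M : Matrix ι ι ℂ, M.PosSemidef → 0 ≤ φ M)
    (hφ1 : ∀ M : Matrix ι ι ℂ, M.PosSemidef → φ M ≤ M.trace)
    (hφd : (d : ℂ) * φ 1 = Fintype.card ι) :
    (φ τ).re * Real.logb 2 d - 1 ≤ globalPurity τ := by
  have := hτ.nonempty
  obtain ⟨V, hV, hVτ⟩ := exists_unitary_diagonalization hτ.posSemidef.isHermitian
  have hts := hτ.sum_eigenvalues
  have ht0 := hτ.posSemidef.eigenvalues_nonneg
  generalize hτ.posSemidef.isHermitian.eigenvalues = t at *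
  have hVV : V * Vᴴ = 1 := Matrix.mem_unitaryGroup_iff.1 hV
  have hVV' : Vᴴ * V = 1 := Matrix.mem_unitaryGroup_iff'.1 hV
  -- The rank-one eigenprojections of `τ`. The numbers `φ (F i)` lie in `[0, 1]` and reduce the
  -- claim to the classical inequality.
  set F : ι → Matrix ι ι ℂ := fun i => V * Matrix.diagonal (Pi.single i 1) * Vᴴ with hF
  have hFpos : ∀ i, (F i).PosSemidef := fun i => by
    refine (Matrix.PosSemidef.diagonal ?_).mul_mul_conjTranspose_same V
    exact Pi.single_nonneg.2 zero_le_one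
  have hFtr : ∀ i, (F i).trace = 1 := fun i => by
    simp only [hF]
    rw [Matrix.trace_mul_comm, ← mul_assoc, hVV', one_mul, Matrix.trace_diagonal]
    simp
  have hFsum : ∀ s : ι → ℂ, ∑ i, s i • F i = V * Matrix.diagonal s * Vᴴ := fun s => by
    have h : Matrix.diagonal s = ∑ i, s i • Matrix.diagonal (Pi.single i (1 : ℂ)) := by
      ext x y
      by_cases hxy : x = y
      · subst hxy
        simp [Matrix.sum_apply, Pi.single_apply]
      · simp [Matrix.sum_apply, hxy]
    rw [h, Finset.mul_sum, Finset.sum_mul]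
    simp [hF]
  have hF1 : ∑ i, F i = 1 := by
    have := hFsum fun _ => 1
    simpa [hVV] using this
  have he : ∀ i, φ (F i) = ((φ (F i)).re : ℂ) := fun i =>
    (Complex.eq_re_of_ofReal_le (r := 0) (by simpa using hφ0 _ (hFpos i)))
  have hφτ : (φ τ).re = ∑ i, t i * (φ (F i)).re := by
    rw [hVτ, ← hFsum, map_sum, Complex.re_sum]
    simp
  have hsum := sum_mul_logb_le (e := fun i => (φ (F i)).re) (d := d) ht0 hts
    (fun i => (Complex.le_def.1 (hφ0 _ (hFpos i))).1)
    (fun i => by simpa [hFtr] using (Complex.le_def.1 (hφ1 _ (hFpos i))).1)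
    (by exact_mod_cast hd) (by
      rw [← hF1, map_sum] at hφd
      have := congrArg Complex.re hφd
      simpa [← Complex.ofReal_natCast, Complex.re_ofReal_mul, -Complex.ofReal_natCast] using this)
  rw [hφτ, globalPurity]
  conv_rhs => rw [hVτ, entropy_conj_diagonal hV]
  linarith

end Purity

/-! ### Trace norm and projections -/

section TraceNorm

variable {ι : Type*} [Fintype ι]

theorem norm_sq_toLp_mulVec (X : Matrix ι ι ℂ) (v : ι → ℂ) :
    ‖WithLp.toLp 2 (X *ᵥ v)‖ ^ 2 = (star v ⬝ᵥ ((Xᴴ * X) *ᵥ v)).re := by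
  rw [← Matrix.mulVec_mulVec, Matrix.dotProduct_mulVec, ← Matrix.star_mulVec,
    ← inner_self_eq_norm_sq (𝕜 := ℂ), EuclideanSpace.inner_eq_star_dotProduct, dotProduct_comm]
  rfl

theorem trace_conjTranspose_mul_mul (V Y : Matrix ι ι ℂ) :
    (Vᴴ * (Y * V)).trace = ∑ i, star (Vᵀ i) ⬝ᵥ (Y *ᵥ Vᵀ i) := by
  simp [Matrix.trace, Matrix.mul_apply, dotProduct, Matrix.mulVec]

theorem trace_mul_nonneg_of_projection {M P : Matrix ι ι ℂ} (hM : M.PosSemidef)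
    (hP : P.IsHermitian) (hPP : P * P = P) : 0 ≤ (M * P).trace := by
  have h : (M * P).trace = (P * M * Pᴴ).trace := by
    rw [hP.eq, Matrix.trace_mul_comm (P * M), ← mul_assoc, hPP, Matrix.trace_mul_comm]
  rw [h]
  exact (hM.mul_mul_conjTranspose_same P).trace_nonneg

variable [DecidableEq ι]

/-- Pythagoras: `‖v‖² = ‖Pv‖² + ‖(1 - P)v‖²`. -/
theorem norm_toLp_mulVec_le {P : Matrix ι ι ℂ} (hP : P.IsHermitian) (hPP : P * P = P)
    (v : ι → ℂ) : ‖WithLp.toLp 2 (P *ᵥ v)‖ ≤ ‖WithLp.toLp 2 v‖ := by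
  have h1 := norm_sq_toLp_mulVec P v
  have h2 := norm_sq_toLp_mulVec (1 - P) v
  have h3 := norm_sq_toLp_mulVec (1 : Matrix ι ι ℂ) v
  have hQ : (1 - P)ᴴ * (1 - P) = 1 - P := by
    rw [(Matrix.isHermitian_one.sub hP).eq, sub_mul, one_mul, mul_sub, mul_one, hPP, sub_self,
      sub_zero]
  rw [hP.eq, hPP] at h1
  rw [hQ, Matrix.sub_mulVec, dotProduct_sub, Complex.sub_re] at h2
  rw [Matrix.conjTranspose_one, one_mul, Matrix.one_mulVec] at h3
  rw [Matrix.one_mulVec] at h2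
  refine abs_le_of_sq_le_sq' ?_ (norm_nonneg _) |>.2
  nlinarith [sq_nonneg ‖WithLp.toLp 2 ((1 - P) *ᵥ v)‖]

/-- Hölder's inequality for the trace norm and projections. -/
theorem norm_trace_mul_le_traceNorm (X : Matrix ι ι ℂ) {P : Matrix ι ι ℂ} (hP : P.IsHermitian)
    (hPP : P * P = P) : ‖(X * P).trace‖ ≤ traceNorm X := by
  have hA := Matrix.isHermitian_conjTranspose_mul_self X
  have hV : (hA.eigenvectorUnitary : Matrix ι ι ℂ) * (hA.eigenvectorUnitary : Matrix ι ι ℂ)ᴴ = 1 :=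
    Matrix.mem_unitaryGroup_iff.1 hA.eigenvectorUnitary.2
  -- In an eigenbasis `vᵢ` of `X† X` the norms `‖X vᵢ‖` are the singular values, and each summand is
  -- `⟨P vᵢ, X vᵢ⟩`, to be bounded by Cauchy-Schwarz.
  have htr : (X * P).trace = ∑ i, star ⇑(hA.eigenvectorBasis i) ⬝ᵥ
      ((P * X) *ᵥ ⇑(hA.eigenvectorBasis i)) := by
    rw [Matrix.trace_mul_comm]
    conv_lhs => rw [← mul_one (P * X), ← hV, ← mul_assoc, Matrix.trace_mul_comm,
      trace_conjTranspose_mul_mul]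
    rfl
  rw [htr, traceNorm]
  refine (norm_sum_le _ _).trans (Finset.sum_le_sum fun i _ => ?_)
  have hX : ‖WithLp.toLp 2 (X *ᵥ ⇑(hA.eigenvectorBasis i))‖ = √(hA.eigenvalues i) := by
    rw [hA.eigenvalues_eq i, ← Real.sqrt_sq (norm_nonneg _)]
    exact congrArg Real.sqrt (norm_sq_toLp_mulVec X _)
  have h1 : star ⇑(hA.eigenvectorBasis i) ⬝ᵥ ((P * X) *ᵥ ⇑(hA.eigenvectorBasis i)) =
      inner ℂ (WithLp.toLp 2 (P *ᵥ ⇑(hA.eigenvectorBasis i)))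
        (WithLp.toLp 2 (X *ᵥ ⇑(hA.eigenvectorBasis i))) := by
    rw [EuclideanSpace.inner_eq_star_dotProduct, ← Matrix.mulVec_mulVec,
      Matrix.dotProduct_mulVec]
    nth_rw 1 [← hP.eq]
    rw [← Matrix.star_mulVec, dotProduct_comm]
  rw [h1, ← hX]
  refine (norm_inner_le_norm _ _).trans ?_
  have h2 := norm_toLp_mulVec_le hP hPP ⇑(hA.eigenvectorBasis i)
  have h3 : ‖WithLp.toLp 2 (⇑(hA.eigenvectorBasis i))‖ = 1 := hA.eigenvectorBasis.orthonormal.1 i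
  rw [h3] at h2
  exact mul_le_of_le_one_left (norm_nonneg _) h2

theorem trace_mul_le_trace_of_projection {M P : Matrix ι ι ℂ} (hM : M.PosSemidef)
    (hP : P.IsHermitian) (hPP : P * P = P) : (M * P).trace ≤ M.trace := by
  have h := trace_mul_nonneg_of_projection hM (Matrix.isHermitian_one.sub hP)
    (by rw [sub_mul, one_mul, mul_sub, mul_one, hPP, sub_self, sub_zero])
  rw [mul_sub, mul_one, Matrix.trace_sub] at h
  exact sub_nonneg.1 h

end TraceNorm

/-! ### Local idits and the test that detects them -/

theorem twisting_mem_unitaryGroup {d : ℕ} {κ : Type*} [Fintype κ] [DecidableEq κ]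
    {U : Fin d → Matrix κ κ ℂ} (hU : ∀ i, U i ∈ Matrix.unitaryGroup κ ℂ) :
    twisting U ∈ Matrix.unitaryGroup (Fin d × κ) ℂ := by
  have h : twisting U = (Matrix.blockDiagonal U).submatrix (Equiv.prodComm _ _)
      (Equiv.prodComm _ _) := by
    ext x y
    simp [twisting, Matrix.blockDiagonal_apply]
  rw [Matrix.mem_unitaryGroup_iff, Matrix.star_eq_conjTranspose, h, Matrix.conjTranspose_submatrix,
    Matrix.submatrix_mul_equiv, Matrix.blockDiagonal_conjTranspose, ← Matrix.blockDiagonal_mul]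
  have h1 : (fun k => U k * (U k)ᴴ) = 1 := funext fun k => Matrix.mem_unitaryGroup_iff.1 (hU k)
  rw [h1, Matrix.blockDiagonal_one, Matrix.submatrix_one_equiv]

theorem plusProj_isHermitian (d : ℕ) : (plusProj d).IsHermitian := by
  ext i j
  simp [plusProj]

theorem plusProj_mul_self {d : ℕ} (hd : 0 < d) : plusProj d * plusProj d = plusProj d := by
  ext i j
  have : (d : ℂ) ≠ 0 := by exact_mod_cast hd.ne'
  simp [plusProj, Matrix.mul_apply, this]

theorem trace_plusProj {d : ℕ} (hd : 0 < d) : (plusProj d).trace = 1 := by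
  have : (d : ℂ) ≠ 0 := by exact_mod_cast hd.ne'
  simp [plusProj, Matrix.trace, this]

theorem trace_submatrix_equiv {ι κ : Type*} [Fintype ι] [Fintype κ] (M : Matrix ι ι ℂ)
    (e : κ ≃ ι) : (M.submatrix e e).trace = M.trace :=
  e.sum_comp fun i => M i i

/-- A local idit with `log₂ d` private bits is detected by a projection of relative rank `1 / d`. -/
theorem IsLocalIdit.exists_projection {d a b : ℕ}
    {α : Matrix (Fin a × Fin b) (Fin a × Fin b) ℂ} (hα : IsLocalIdit d α) :
    ∃ P : Matrix (Fin a × Fin b) (Fin a × Fin b) ℂ, P.IsHermitian ∧ P * P = P ∧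
      (α * P).trace = 1 ∧ (d : ℂ) * P.trace = a * b := by
  obtain ⟨hd, k, e, U, σ, hU, hσ, rfl⟩ := hα
  let g : Fin a × Fin b ≃ Fin d × Fin k × Fin b :=
    (e.prodCongr (Equiv.refl _)).trans (Equiv.prodAssoc _ _ _)
  change ∃ P : Matrix (Fin a × Fin b) (Fin a × Fin b) ℂ, P.IsHermitian ∧ P * P = P ∧
    ((twisting U * (plusProj d ⊗ₖ σ) * (twisting U)ᴴ).submatrix g g * P).trace = 1 ∧
      (d : ℂ) * P.trace = a * b
  set W := twisting U
  have hW : Wᴴ * W = 1 := Matrix.mem_unitaryGroup_iff'.1 (twisting_mem_unitaryGroup hU)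
  -- The untwisted test; the projection sought is its conjugate by the twisting `W`.
  set Q : Matrix (Fin d × Fin k × Fin b) (Fin d × Fin k × Fin b) ℂ :=
    plusProj d ⊗ₖ (1 : Matrix (Fin k × Fin b) (Fin k × Fin b) ℂ)
  have hmul : ∀ X : Matrix (Fin d × Fin k × Fin b) (Fin d × Fin k × Fin b) ℂ,
      W * X * Wᴴ * (W * Q * Wᴴ) = W * (X * Q) * Wᴴ := fun X => by
    calc W * X * Wᴴ * (W * Q * Wᴴ) = W * X * (Wᴴ * W) * Q * Wᴴ := by simp only [mul_assoc]
      _ = W * (X * Q) * Wᴴ := by rw [hW, mul_one, mul_assoc W]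
  have htr : ∀ X, (W * X * Wᴴ).trace = X.trace := fun X => by
    rw [Matrix.trace_mul_comm, ← mul_assoc, hW, one_mul]
  have hQH : Q.IsHermitian := by
    rw [Matrix.IsHermitian, Matrix.conjTranspose_kronecker, (plusProj_isHermitian d).eq,
      Matrix.conjTranspose_one]
  have hcard : a = d * k := by simpa using Fintype.card_congr e
  refine ⟨(W * Q * Wᴴ).submatrix g g, ?_, ?_, ?_, ?_⟩
  · exact (Matrix.isHermitian_mul_mul_conjTranspose W hQH).submatrix g
  · rw [Matrix.submatrix_mul_equiv, hmul, ← Matrix.mul_kronecker_mul, plusProj_mul_self hd,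
      one_mul]
  · rw [Matrix.submatrix_mul_equiv, hmul, trace_submatrix_equiv, htr, ← Matrix.mul_kronecker_mul,
      plusProj_mul_self hd, mul_one, Matrix.trace_kronecker, trace_plusProj hd, hσ.trace_eq_one,
      one_mul]
  · rw [trace_submatrix_equiv, htr, Matrix.trace_kronecker, trace_plusProj hd, hcard]
    simp
    ring

/-! ### Partial trace, copies and the rate bound -/

theorem posSemidef_traceC {a c b : ℕ} {M : Matrix (Tri a c b) (Tri a c b) ℂ}
    (hM : M.PosSemidef) : (traceC M).PosSemidef := by
  have h : traceC M = ∑ z : Fin c, M.submatrix (fun x : Fin a × Fin b => (x.1, z, x.2))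
      (fun x => (x.1, z, x.2)) := by
    ext x y
    simp [traceC, Matrix.sum_apply]
  rw [h]
  exact Matrix.posSemidef_sum _ fun z _ => hM.submatrix _

theorem trace_traceC {a c b : ℕ} (M : Matrix (Tri a c b) (Tri a c b) ℂ) :
    (traceC M).trace = M.trace := by
  simp only [Matrix.trace, Matrix.diag_apply, traceC, Matrix.of_apply, Fintype.sum_prod_type]
  exact Finset.sum_congr rfl fun i _ => Finset.sum_comm

theorem traceC_one {a c b : ℕ} :
    traceC (1 : Matrix (Tri a c b) (Tri a c b) ℂ) = (c : ℂ) • 1 := by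
  ext x y
  simp [traceC, Matrix.one_apply, Prod.ext_iff]

theorem transposeC_one {a c b : ℕ} : transposeC (1 : Matrix (Tri a c b) (Tri a c b) ℂ) = 1 := by
  ext x y
  simp only [transposeC, Matrix.of_apply, Matrix.one_apply, Prod.ext_iff,
    eq_comm (a := x.2.1) (b := y.2.1)]

theorem trace_transposeC {a c b : ℕ} (M : Matrix (Tri a c b) (Tri a c b) ℂ) :
    (transposeC M).trace = M.trace := rfl

/-- Basis labels of `n` copies of `AC₁C₂B`. -/
def copiesEquiv (a c₁ c₂ b n : ℕ) :
    Tri (a ^ n) ((c₁ * c₂) ^ n) (b ^ n) ≃ (Fin n → (Fin a × Fin c₁) × (Fin c₂ × Fin b)) where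
  toFun x k := ((finFunctionFinEquiv.symm x.1 k, (finFunctionFinEquiv.symm x.2.1 k).divNat),
    ((finFunctionFinEquiv.symm x.2.1 k).modNat, finFunctionFinEquiv.symm x.2.2 k))
  invFun f := (finFunctionFinEquiv fun k => (f k).1.1,
    finFunctionFinEquiv fun k => finProdFinEquiv ((f k).1.2, (f k).2.1),
    finFunctionFinEquiv fun k => (f k).2.2)
  left_inv x := by
    have h : ∀ z : Fin (c₁ * c₂), finProdFinEquiv (z.divNat, z.modNat) = z :=
      finProdFinEquiv.apply_symm_apply
    simp only [h, Equiv.apply_symm_apply]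
  right_inv f := by
    have h : ∀ z : Fin c₁ × Fin c₂,
        ((finProdFinEquiv z).divNat, (finProdFinEquiv z).modNat) = z :=
      finProdFinEquiv.symm_apply_apply
    have h1 : ∀ z, (finProdFinEquiv z).divNat = z.1 := fun z => congrArg Prod.fst (h z)
    have h2 : ∀ z, (finProdFinEquiv z).modNat = z.2 := fun z => congrArg Prod.snd (h z)
    simp only [Equiv.symm_apply_apply, h1, h2]

/-- On `C₂B` the transposed factor is the first one, and transposing it is the full transpose of
`partialTranspose ρ'`; this changes neither positivity nor entropy. -/
theorem transposeC_copies {a c₁ c₂ b : ℕ} (ρ : Matrix (Fin a × Fin c₁) (Fin a × Fin c₁) ℂ)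
    (ρ' : Matrix (Fin c₂ × Fin b) (Fin c₂ × Fin b) ℂ) (n : ℕ) :
    transposeC (copies ρ ρ' n) =
      (tensorPower (partialTranspose ρ ⊗ₖ (partialTranspose ρ')ᵀ) n).submatrix
        (copiesEquiv a c₁ c₂ b n) (copiesEquiv a c₁ c₂ b n) := rfl

theorem CLODCC.mul_logb_le {a c b a' c' b' d : ℕ} {Λ : TriMap a c b a' c' b'} (hΛ : CLODCC Λ)
    {α : Matrix (Fin a' × Fin b') (Fin a' × Fin b') ℂ} (hα : IsLocalIdit d α)
    {τ : Matrix (Tri a c b) (Tri a c b) ℂ} (hτ : IsState (transposeC τ)) {ε : ℝ}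
    (hε : traceNorm (traceC (Λ τ) - α) ≤ ε) :
    (1 - ε) * Real.logb 2 d - 1 ≤ globalPurity (transposeC τ) := by
  obtain ⟨P, hP, hPP, hαP, hdP⟩ := hα.exists_projection
  have hb := hΛ.isPPTBistochastic
  let φ : Matrix (Tri a c b) (Tri a c b) ℂ →ₗ[ℂ] ℂ :=
    { toFun := fun M => (traceC (Λ (transposeC M)) * P).trace
      map_add' := fun M N => by
        have h1 : transposeC (M + N) = transposeC M + transposeC N := rfl
        have h2 : ∀ X Y : Matrix (Tri a' c' b') (Tri a' c' b') ℂ,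
            traceC (X + Y) = traceC X + traceC Y := fun X Y => by
          ext x y
          simp [traceC, Finset.sum_add_distrib]
        rw [h1, map_add, h2, add_mul, Matrix.trace_add]
      map_smul' := fun r M => by
        have h1 : transposeC (r • M) = r • transposeC M := rfl
        have h2 : ∀ X : Matrix (Tri a' c' b') (Tri a' c' b') ℂ,
            traceC (r • X) = r • traceC X := fun X => by
          ext x y
          simp [traceC, Finset.mul_sum]
        rw [h1, map_smul, h2, Matrix.smul_mul, Matrix.trace_smul, RingHom.id_apply] }
  have hφ : ∀ M, φ M = (traceC (Λ (transposeC M)) * P).trace := fun _ => rfl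
  have hpos : ∀ M : Matrix (Tri a c b) (Tri a c b) ℂ, M.PosSemidef →
      (traceC (Λ (transposeC M))).PosSemidef := fun M hM =>
    -- `traceC` only reads entries diagonal in `C`, so it takes the same value, by definition, on a
    -- matrix and on its `transposeC`.
    posSemidef_traceC (M := transposeC (Λ (transposeC M)))
      (hb.posSemidef_map (transposeC M) hM)
  -- A unital trace preserving map cannot change the total dimension.
  have hcard : (Fintype.card (Tri a c b) : ℂ) = a' * (c' * b') := by
    have := hb.trace_map 1
    rw [hb.map_one, Matrix.trace_one, Matrix.trace_one] at this
    rw [← this]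
    simp
  have hmain := hτ.mul_logb_sub_one_le_globalPurity φ hα.1
    (fun M hM => trace_mul_nonneg_of_projection (hpos M hM) hP hPP)
    (fun M hM => by
      refine (trace_mul_le_trace_of_projection (hpos M hM) hP hPP).trans_eq ?_
      rw [trace_traceC, hb.trace_map, trace_transposeC])
    (by
      rw [hφ, transposeC_one, hb.map_one, traceC_one, Matrix.smul_mul, one_mul,
        Matrix.trace_smul, hcard, smul_eq_mul, mul_left_comm, hdP]
      ring)
  rw [hφ, transposeC_transposeC] at hmain
  have hp : 1 - ε ≤ (traceC (Λ τ) * P).trace.re := by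
    have h := ((Complex.abs_re_le_norm _).trans
      (norm_trace_mul_le_traceNorm (traceC (Λ τ) - α) hP hPP)).trans hε
    rw [sub_mul, Matrix.trace_sub, hαP, Complex.sub_re, Complex.one_re] at h
    linarith [(abs_le.1 h).1]
  have hlog : 0 ≤ Real.logb 2 d :=
    Real.logb_nonneg one_lt_two (by exact_mod_cast hα.1)
  linarith [mul_le_mul_of_nonneg_right hp hlog]

theorem repeaterRate_le {a c₁ c₂ b : ℕ} {ρ : Matrix (Fin a × Fin c₁) (Fin a × Fin c₁) ℂ}
    {ρ' : Matrix (Fin c₂ × Fin b) (Fin c₂ × Fin b) ℂ} (hρ : IsState (partialTranspose ρ))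
    (hρ' : IsState (partialTranspose ρ')) :
    repeaterRate ρ ρ' ≤
      ((globalPurity (partialTranspose ρ ⊗ₖ partialTranspose ρ') : ℝ) : EReal) := by
  set G := globalPurity (partialTranspose ρ ⊗ₖ partialTranspose ρ') with hG
  have hT := hρ.kronecker hρ'.transpose
  have hGT : globalPurity (partialTranspose ρ ⊗ₖ (partialTranspose ρ')ᵀ) = G := by
    rw [globalPurity_kronecker hρ hρ'.transpose,
      globalPurity_transpose hρ'.posSemidef.isHermitian, hG, globalPurity_kronecker hρ hρ']
  -- The one-shot bound `(1 - ε) log d - 1 ≤ n G`, solved for `log d / n`.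
  have hbound : ∀ (ε : ℝ) (n : ℕ), ε < 1 → 0 < n → ∀ r ∈ achievable ρ ρ' ε n,
      r ≤ (((G + 1 / n) / (1 - ε) : ℝ) : EReal) := by
    rintro ε n hε hn r ⟨d, oa, oc, ob, Λ, α, hΛ, hα, hle, rfl⟩
    have hτ : IsState (transposeC (copies ρ ρ' n)) := by
      rw [transposeC_copies]
      exact (hT.tensorPower n).submatrix_equiv _
    have h := hΛ.mul_logb_le hα hτ hle
    rw [transposeC_copies, globalPurity_submatrix_equiv (hT.tensorPower n).posSemidef.isHermitian,
      globalPurity_tensorPower hT, hGT] at h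
    have hn' : (0 : ℝ) < n := by exact_mod_cast hn
    rw [EReal.coe_le_coe_iff, div_le_div_iff₀ hn' (by linarith)]
    have : (G + 1 / n) * n = n * G + 1 := by field_simp
    rw [this]
    linarith
  have hlim : ∀ ε : ℝ, 0 < ε → ε < 1 → repeaterRate ρ ρ' ≤ ((G / (1 - ε) : ℝ) : EReal) := by
    intro ε hε hε1
    refine (iInf₂_le ε hε).trans ?_
    have ht : Filter.Tendsto (fun n : ℕ => (((G + 1 / n) / (1 - ε) : ℝ) : EReal)) Filter.atTop
        (nhds ((G / (1 - ε) : ℝ) : EReal)) := by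
      refine (continuous_coe_real_ereal.tendsto _).comp (Filter.Tendsto.div_const ?_ _)
      simpa using tendsto_one_div_atTop_nhds_zero_nat.const_add G
    rw [← ht.limsup_eq]
    refine Filter.limsup_le_limsup ?_
    filter_upwards [Filter.eventually_gt_atTop 0] with n hn
    exact sSup_le (hbound ε n hε1 hn)
  have ht : Filter.Tendsto (fun ε : ℝ => ((G / (1 - ε) : ℝ) : EReal)) (nhdsWithin 0 (Set.Ioi 0))
      (nhds (G : EReal)) := by
    refine (continuous_coe_real_ereal.tendsto _).comp ?_
    have hc : ContinuousAt (fun ε : ℝ => G / (1 - ε)) 0 :=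
      continuousAt_const.div (by fun_prop) (by norm_num)
    simpa [ContinuousAt] using hc.tendsto.mono_left nhdsWithin_le_nhds
  refine ge_of_tendsto ht ?_
  filter_upwards [Ioo_mem_nhdsGT (zero_lt_one' ℝ)] with ε hε
  exact hlim ε hε.1 hε.2

end PrivateRandomness

theorem mainTheorem7 (a c₁ c₂ b : ℕ)
    (ρ : Matrix (Fin a × Fin c₁) (Fin a × Fin c₁) ℂ)
    (ρ' : Matrix (Fin c₂ × Fin b) (Fin c₂ × Fin b) ℂ)
    (hρ : PrivateRandomness.IsState ρ) (hρ' : PrivateRandomness.IsState ρ')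
    (hppt : (PrivateRandomness.partialTranspose ρ).PosSemidef)
    (hppt' : (PrivateRandomness.partialTranspose ρ').PosSemidef) :
    PrivateRandomness.repeaterRate ρ ρ' ≤
        ((PrivateRandomness.globalPurity
          (PrivateRandomness.partialTranspose ρ ⊗ₖ PrivateRandomness.partialTranspose ρ') : ℝ) :
          EReal) ∧
      ((PrivateRandomness.globalPurity
          (PrivateRandomness.partialTranspose ρ ⊗ₖ PrivateRandomness.partialTranspose ρ') : ℝ) :
          EReal) =
        PrivateRandomness.relEntropy (PrivateRandomness.partialTranspose ρ)
            (PrivateRandomness.maximallyMixed (Fin a × Fin c₁)) +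
          PrivateRandomness.relEntropy (PrivateRandomness.partialTranspose ρ')
            (PrivateRandomness.maximallyMixed (Fin c₂ × Fin b)) := by
  have h := hρ.partialTranspose hppt
  have h' := hρ'.partialTranspose hppt'
  refine ⟨PrivateRandomness.repeaterRate_le h h', ?_⟩
  rw [PrivateRandomness.relEntropy_maximallyMixed h,
    PrivateRandomness.relEntropy_maximallyMixed h',
    PrivateRandomness.globalPurity_kronecker h h', EReal.coe_add]
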